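/- Let $\mathcal H$ be a complex Hilbert space with orthonormal basis $\{e_n\}_{n\ge 1}$, and let $W\in B(\mathcal H)$ be a (unilateral) weighted shift, i.e. a bounded linear operator with $We_n=\alpha_n e_{n+1}$ for all $n\ge 1$, whose weights $\alpha_n$ are all nonzero complex numbers. Write $\pi:B(\mathcal H)\to B(\mathcal H)/K(\mathcal H)$ for the quotient map onto the Calkin algebra, where $K(\mathcal H)$ is the ideal of compact operators, and let $\sigma_e(W)$ be the essential spectrum of $W$, i.e. the spectrum of $\pi(W)$ in the Calkin algebra. Let $\mathcal S(W,W^*)$ be the multiplicative semigroup generated by $W$ and $W^*$, i.e. the set of all nonempty finite products of $W$'s and $W^*$'s. Suppose that $W$ is essentially normal, i.e. $\pi(W)$ is normal in the Calkin algebra, and that $\mathcal S=\mathcal S(W,W^*)$ is a selfadjoint-ideal (SI) semigroup: every ideal $J$ of $\mathcal S$ (a subset $J\subseteq\mathcal S$ such that $XT\in J$ and $TX\in J$ for all $X\in\mathcal S$ and $T\in J$) is closed under adjoints, i.e. $T^*\in J$ whenever $T\in J$. Then $$\sigma_e(W)\subseteq S^1\cup\{0\}\qquad\text{and}\qquad \sigma(W)=\overline{\mathbb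 D},$$ where $S^1=\{z\in\mathbb C:|z|=1\}$ and $\overline{\mathbb D}=\{z\in\mathbb C:|z|\le 1\}$. Moreover, $$\liminf_{n\to\infty}|\alpha_1\alpha_2\cdots\alpha_n|^{1/n}=1.$$ -/

import Mathlib

open Filter Topology

/-- A subset `J` of the semigroup `S` is an ideal of `S` when it is closed under left and right
products with elements of `S`. -/
def IsSemigroupIdeal {M : Type*} [Mul M] (S : Subsemigroup M) (J : Set M) : Prop :=
  J ⊆ (S : Set M) ∧ ∀ X ∈ S, ∀ T ∈ J, X * T ∈ J ∧ T * X ∈ J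

/-- A selfadjoint-ideal (SI) semigroup: every ideal of `S` is closed under the involution. -/
def IsSISemigroup {M : Type*} [Mul M] [Star M] (S : Subsemigroup M) : Prop :=
  ∀ J : Set M, IsSemigroupIdeal S J → ∀ T ∈ J, star T ∈ J

/-- `𝒮(T, T*)`: the semigroup generated by `T` and `T*`, that is, all nonempty finite words in
`T` and `T*`. -/
def selfadjointSemigroup {M : Type*} [Mul M] [Star M] (T : M) : Subsemigroup M :=
  Subsemigroup.closure {T, star T}

section Calkin

variable (H : Type*) [NormedAddCommGroup H] [InnerProductSpace ℂ H] [CompleteSpace H]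

/-- The ideal `K(H)` of compact operators in `B(H)`. -/
def compactIdeal : Ideal (H →L[ℂ] H) where
  carrier := {T | IsCompactOperator T}
  zero_mem' := isCompactOperator_zero
  add_mem' := fun hS hT => hS.add hT
  smul_mem' := fun S _ hT => hT.clm_comp S

instance compactIdeal_isTwoSided : (compactIdeal H).IsTwoSided where
  mul_mem_of_left := fun S hT => IsCompactOperator.comp_clm hT S

/-- The Calkin algebra `B(H)/K(H)`. -/
abbrev CalkinAlgebra : Type _ := (H →L[ℂ] H) ⧸ compactIdeal H

variable {H}

/-- The quotient map `π : B(H) → B(H)/K(H)`. -/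
def toCalkin : (H →L[ℂ] H) →ₐ[ℂ] CalkinAlgebra H := Ideal.Quotient.mkₐ ℂ (compactIdeal H)

/-- The adjoint of a compact operator is compact. -/
theorem star_mem_compactIdeal {T : H →L[ℂ] H} (hT : T ∈ compactIdeal H) :
    star T ∈ compactIdeal H := by
  have hc : IsCompactOperator (T * star T : H →L[ℂ] H) :=
    IsCompactOperator.comp_clm (f := T) hT (star T)
  have key : ∀ y : H, ‖star T y‖ ^ 2 ≤ ‖(T * star T) y‖ * ‖y‖ := by
    intro y
    have h1 : inner ℂ (star T y) (star T y) = inner ℂ ((T * star T) y) y := by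
      rw [ContinuousLinearMap.star_eq_adjoint, ContinuousLinearMap.adjoint_inner_right]
      rfl
    rw [← inner_self_eq_norm_sq (𝕜 := ℂ), h1]
    exact (RCLike.re_le_norm _).trans (norm_inner_le_norm _ _)
  change IsCompactOperator (star T : H →L[ℂ] H)
  refine (isCompactOperator_iff_isCompact_closure_image_closedBall
    ((star T : H →L[ℂ] H) : H →ₗ[ℂ] H) one_pos).2 ?_
  refine TotallyBounded.isCompact_of_isClosed (TotallyBounded.closure ?_) isClosed_closure
  have htb : TotallyBounded ((T * star T : H →L[ℂ] H) '' Metric.closedBall (0 : H) 1) :=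
    ((isCompactOperator_iff_isCompact_closure_image_closedBall
      ((T * star T : H →L[ℂ] H) : H →ₗ[ℂ] H) one_pos).1 hc).totallyBounded.subset subset_closure
  rw [Metric.totallyBounded_iff]
  intro ε hε
  obtain ⟨F, hFs, hF, hcov⟩ := Metric.finite_approx_of_totallyBounded htb (ε ^ 2 / 2) (by positivity)
  choose! g hg using fun z (hz : z ∈ F) => hFs hz
  refine ⟨(fun z => star T (g z)) '' F, hF.image _, ?_⟩
  rintro _ ⟨y, hy, rfl⟩
  obtain ⟨z, hzF, hz⟩ := Set.mem_iUnion₂.1 (hcov ⟨y, hy, rfl⟩)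
  refine Set.mem_iUnion₂.2 ⟨_, ⟨z, hzF, rfl⟩, ?_⟩
  obtain ⟨hgb, hgz⟩ := hg z hzF
  rw [Metric.mem_ball, dist_eq_norm] at hz ⊢
  have hk := key (y - g z)
  rw [map_sub, map_sub, hgz] at hk
  have hn : ‖y - g z‖ ≤ 2 := by
    have := norm_sub_le y (g z)
    rw [mem_closedBall_zero_iff] at hy hgb
    linarith
  have h3 : ‖(star T) y - (star T) (g z)‖ ^ 2 < ε ^ 2 := by
    have h0 := norm_nonneg (y - g z)
    have h1 := norm_nonneg ((T * star T) y - z)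
    calc _ ≤ _ := hk
      _ ≤ ‖(T * star T) y - z‖ * 2 := by gcongr
      _ < ε ^ 2 := by
        have : ‖(T * star T) y - z‖ < ε ^ 2 / 2 := hz
        linarith
  exact lt_of_pow_lt_pow_left₀ 2 hε.le h3

/-- The involution `π(T)* = π(T*)` of the Calkin algebra. -/
noncomputable instance calkinStarRing : StarRing (CalkinAlgebra H) where
  star := Quotient.map star (by
    intro S T h
    refine (Submodule.quotientRel_def (compactIdeal H)).2 ?_
    rw [← star_sub]
    exact star_mem_compactIdeal ((Submodule.quotientRel_def (compactIdeal H)).1 h))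
  star_involutive := by
    rintro ⟨T⟩
    exact congrArg (Ideal.Quotient.mk (compactIdeal H)) (star_star T)
  star_mul := by
    rintro ⟨S⟩ ⟨T⟩
    exact congrArg (Ideal.Quotient.mk (compactIdeal H)) (star_mul S T)
  star_add := by
    rintro ⟨S⟩ ⟨T⟩
    exact congrArg (Ideal.Quotient.mk (compactIdeal H)) (star_add S T)

theorem star_toCalkin (T : H →L[ℂ] H) : star (toCalkin T) = toCalkin (star T) := rfl

/-- `T` is essentially normal: its image in the Calkin algebra is normal. -/
def IsEssentiallyNormal (T : H →L[ℂ] H) : Prop := IsStarNormal (toCalkin T)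

/-- The essential spectrum `σ_e(T)`: the spectrum of `π(T)` in the Calkin algebra. -/
def essentialSpectrum (T : H →L[ℂ] H) : Set ℂ := spectrum ℂ (toCalkin T)

/-- `W` is the (unilateral) weighted shift with weights `α` relative to the orthonormal basis `e`.
Indices start at `0`: `e n` and `α n` are the customary `e_{n+1}` and `α_{n+1}`. -/
def IsWeightedShift (e : HilbertBasis ℕ ℂ H) (α : ℕ → ℂ) (W : H →L[ℂ] H) : Prop :=
  ∀ n, W (e n) = α n • e (n + 1)

end Calkin

/-! Everything follows from `|α n| → 1`. Applying the SI property to the principal ideal of `W`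
writes `W*` as a longer word containing `W`. Far out on the basis both sides move `e (n + 1)` to
multiples of `e n`; comparing moduli and cancelling the weight that both must cross leaves a
nonempty product of weights `|α (n + j)|` equal to `1`, with the same offsets `j` for every `n`
(`exists_prod_norm_eq_one`). Essential normality gives `|α (n + 1)| - |α n| → 0`, so a subsequential
limit `L` of the moduli satisfies `L ^ k = 1` with `k ≥ 1`, hence `L = 1`.

The geometric means then tend to `1`, the growth of weight products identifies `σ(W)`, and `π(W)` is
unitary, which puts `σ_e(W)` on the circle. -/

/-! ### Norms and compactness of diagonal operators -/

section OperatorsOnBasis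

variable {H : Type*} [NormedAddCommGroup H] [InnerProductSpace ℂ H]

/-- The squared norm of a finite orthogonal combination. -/
theorem Orthonormal.norm_sq_sum_smul {ι : Type*} {v : ι → H} (hv : Orthonormal ℂ v)
    (c : ι → ℂ) (s : Finset ι) : ‖∑ i ∈ s, c i • v i‖ ^ 2 = ∑ i ∈ s, ‖c i‖ ^ 2 := by
  have h := hv.inner_sum c c s
  rw [inner_self_eq_norm_sq_to_K] at h
  have h2 : ∀ i, (starRingEnd ℂ) (c i) * c i = ((‖c i‖ ^ 2 : ℝ) : ℂ) := fun i => by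
    rw [mul_comm, Complex.mul_conj, Complex.normSq_eq_norm_sq]
  simp only [h2] at h
  apply Complex.ofReal_injective
  push_cast at h ⊢
  exact h

variable (e : HilbertBasis ℕ ℂ H)

/-- An operator mapping the basis to multiples of distinct basis vectors is bounded by the
supremum of the coefficients. -/
theorem norm_le_of_apply_basis {T : H →L[ℂ] H} {c : ℕ → ℂ} {k : ℕ} {C : ℝ} (hC : 0 ≤ C)
    (hT : ∀ n, T (e n) = c n • e (n + k)) (hc : ∀ n, ‖c n‖ ≤ C) : ‖T‖ ≤ C := by
  have hv : Orthonormal ℂ (fun n => e (n + k)) :=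
    e.orthonormal.comp (fun n => n + k) (add_left_injective k)
  refine T.opNorm_le_bound hC fun x => ?_
  have hx := e.hasSum_repr x
  have hTx := T.hasSum hx
  refine le_of_tendsto_of_tendsto (Filter.Tendsto.norm hTx)
    ((Filter.Tendsto.norm hx).const_mul C) (Eventually.of_forall fun s => ?_)
  refine le_of_sq_le_sq ?_ (by positivity)
  have h1 : ∑ i ∈ s, T (e.repr x i • e i) = ∑ i ∈ s, (e.repr x i * c i) • e (i + k) :=
    Finset.sum_congr rfl fun i _ => by rw [map_smul, hT, smul_smul]
  rw [mul_pow]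
  simp only [h1, hv.norm_sq_sum_smul, e.orthonormal.norm_sq_sum_smul, Finset.mul_sum, norm_mul]
  refine Finset.sum_le_sum fun i _ => ?_
  rw [mul_pow, mul_comm]
  have := hc i
  gcongr

/-- A diagonal operator with entries tending to `0` is compact. -/
theorem isCompactOperator_of_tendsto_zero [CompleteSpace H] {D : H →L[ℂ] H} {d : ℕ → ℂ}
    (hD : ∀ n, D (e n) = d n • e n) (hd : Tendsto d atTop (𝓝 0)) : IsCompactOperator D := by
  -- Finite-rank truncations of `D`, converging to it in norm.
  let P : ℕ → H →L[ℂ] H := fun N =>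
    ∑ i ∈ Finset.range N, (innerSL ℂ (e i)).smulRight (d i • e i)
  have hPc : ∀ N, IsCompactOperator (P N) := by
    intro N
    refine Submodule.sum_mem (compactIdeal H) fun i _ => ?_
    have h : IsCompactOperator (innerSL ℂ (e i)) :=
      isCompactOperator_of_locallyCompactSpace_dom (innerSL ℂ (e i))
    exact h.clm_comp (ContinuousLinearMap.toSpanSingleton ℂ (d i • e i))
  have hPe : ∀ N n, P N (e n) = if n < N then d n • e n else 0 := by
    intro N n
    simp [P, orthonormal_iff_ite.1 e.orthonormal, ite_smul]
  refine isCompactOperator_of_tendsto (l := atTop) (F := P) ?_ (Eventually.of_forall hPc)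
  rw [Metric.tendsto_atTop] at hd ⊢
  intro ε hε
  obtain ⟨N, hN⟩ := hd (ε / 2) (by positivity)
  refine ⟨N, fun m hm => ?_⟩
  rw [dist_eq_norm]
  refine (norm_le_of_apply_basis e (k := 0) (c := fun n => if n < m then 0 else - d n)
    (C := ε / 2) (by positivity) (fun n => ?_) fun n => ?_).trans_lt (by linarith)
  · rw [sub_apply, hPe, hD]
    split_ifs <;> simp
  · split_ifs with h
    · simp; positivity
    · have := hN n (by omega)
      rw [dist_zero_right] at this
      rw [norm_neg]; exact this.le

/-- The entries of a compact diagonal operator tend to `0`. -/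
theorem tendsto_zero_of_isCompactOperator {D : H →L[ℂ] H} {d : ℕ → ℂ}
    (hD : ∀ n, D (e n) = d n • e n) (hc : IsCompactOperator D) : Tendsto d atTop (𝓝 0) := by
  rw [Metric.tendsto_atTop]
  by_contra! hcon
  obtain ⟨ε, hε, hcon⟩ := hcon
  obtain ⟨φ, hφ, hφd⟩ := Filter.extraction_of_frequently_atTop
    (P := fun n => ε ≤ dist (d n) 0) (Filter.frequently_atTop.2 hcon)
  have hK := (isCompactOperator_iff_isCompact_closure_image_closedBall
    ((D : H →L[ℂ] H) : H →ₗ[ℂ] H) one_pos).1 hc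
  obtain ⟨x, -, ψ, hψ, hx⟩ := hK.tendsto_subseq (x := fun n => D (e (φ n))) fun n =>
    subset_closure ⟨e (φ n), by simp [e.orthonormal.1], rfl⟩
  obtain ⟨N, hN⟩ := Metric.cauchySeq_iff'.1 hx.cauchySeq ε hε
  have h := hN (N + 1) (Nat.le_succ N)
  have hne : φ (ψ N) ≠ φ (ψ (N + 1)) := (hφ (hψ (Nat.lt_succ_self N))).ne
  -- Images of distinct basis vectors are orthogonal, so entries of modulus at least `ε` keep them
  -- `ε` apart, against the Cauchy property.
  have hle : ‖d (φ (ψ (N + 1)))‖ ≤ dist (D (e (φ (ψ (N + 1))))) (D (e (φ (ψ N)))) := by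
    have h1 : inner ℂ (e (φ (ψ (N + 1)))) (D (e (φ (ψ (N + 1)))) - D (e (φ (ψ N)))) =
        d (φ (ψ (N + 1))) := by
      rw [hD, hD, inner_sub_right, inner_smul_right, inner_smul_right,
        orthonormal_iff_ite.1 e.orthonormal, orthonormal_iff_ite.1 e.orthonormal]
      simp [hne.symm]
    rw [dist_eq_norm, ← h1]
    refine (norm_inner_le_norm _ _).trans ?_
    rw [e.orthonormal.1, one_mul]
  have := hφd (ψ (N + 1))
  rw [dist_zero_right] at this
  simp only [Function.comp] at h
  linarith

end OperatorsOnBasis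

/-! ### Action of a weighted shift on the basis -/

section WeightedShift

variable {H : Type*} [NormedAddCommGroup H] [InnerProductSpace ℂ H]
  {e : HilbertBasis ℕ ℂ H} {α : ℕ → ℂ} {W : H →L[ℂ] H}

theorem HilbertBasis.ext_inner {x y : H} (e : HilbertBasis ℕ ℂ H)
    (h : ∀ n, inner ℂ (e n) x = inner ℂ (e n) y) : x = y := by
  refine e.repr.injective (lp.ext (funext fun n => ?_))
  rw [e.repr_apply_apply, e.repr_apply_apply, h]

theorem IsWeightedShift.star_apply_zero [CompleteSpace H]
    (hW : IsWeightedShift e α W) : star W (e 0) = 0 := by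
  refine e.ext_inner fun m => ?_
  rw [ContinuousLinearMap.star_eq_adjoint, ContinuousLinearMap.adjoint_inner_right, hW,
    inner_smul_left, orthonormal_iff_ite.1 e.orthonormal]
  simp

theorem IsWeightedShift.star_apply_succ [CompleteSpace H]
    (hW : IsWeightedShift e α W) (n : ℕ) :
    star W (e (n + 1)) = star (α n) • e n := by
  refine e.ext_inner fun m => ?_
  rw [ContinuousLinearMap.star_eq_adjoint, ContinuousLinearMap.adjoint_inner_right, hW,
    inner_smul_left, inner_smul_right, orthonormal_iff_ite.1 e.orthonormal,
    orthonormal_iff_ite.1 e.orthonormal]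
  by_cases h : m = n <;> simp [h]

theorem IsWeightedShift.star_mul_self_apply [CompleteSpace H]
    (hW : IsWeightedShift e α W) (n : ℕ) :
    (star W * W) (e n) = ((‖α n‖ ^ 2 : ℝ) : ℂ) • e n := by
  rw [mul_apply_eq_comp, hW, map_smul, hW.star_apply_succ, smul_smul,
    Complex.star_def, Complex.mul_conj, Complex.normSq_eq_norm_sq]

theorem IsWeightedShift.mul_star_self_apply_succ [CompleteSpace H]
    (hW : IsWeightedShift e α W) (n : ℕ) :
    (W * star W) (e (n + 1)) = ((‖α n‖ ^ 2 : ℝ) : ℂ) • e (n + 1) := by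
  rw [mul_apply_eq_comp, hW.star_apply_succ, map_smul, hW, smul_smul, mul_comm,
    Complex.star_def, Complex.mul_conj, Complex.normSq_eq_norm_sq]

theorem IsWeightedShift.mul_star_self_apply_zero [CompleteSpace H]
    (hW : IsWeightedShift e α W) :
    (W * star W) (e 0) = 0 := by
  rw [mul_apply_eq_comp, hW.star_apply_zero, map_zero]

theorem IsWeightedShift.pow_apply (hW : IsWeightedShift e α W) (k n : ℕ) :
    (W ^ k) (e n) = (∏ i ∈ Finset.range k, α (n + i)) • e (n + k) := by
  induction k with
  | zero => simp
  | succ k ih =>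
    rw [pow_succ', mul_apply_eq_comp, ih, map_smul, hW, smul_smul,
      Finset.prod_range_succ, add_assoc]

theorem IsWeightedShift.norm_weight_le (hW : IsWeightedShift e α W) (n : ℕ) : ‖α n‖ ≤ ‖W‖ := by
  have h := W.le_opNorm (e n)
  rwa [hW, norm_smul, e.orthonormal.1, e.orthonormal.1, mul_one, mul_one] at h

theorem toCalkin_eq_iff {S T : H →L[ℂ] H} :
    toCalkin S = toCalkin T ↔ IsCompactOperator (S - T : H →L[ℂ] H) :=
  Ideal.Quotient.eq

/-- The moduli of the weights of an essentially normal weighted shift vary slowly. -/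
theorem IsWeightedShift.tendsto_norm_succ_sub_norm [CompleteSpace H]
    (hW : IsWeightedShift e α W)
    (hn : IsEssentiallyNormal W) :
    Tendsto (fun n => ‖α (n + 1)‖ - ‖α n‖) atTop (𝓝 0) := by
  have hc : IsCompactOperator (star W * W - W * star W : H →L[ℂ] H) := by
    rw [← toCalkin_eq_iff, map_mul, map_mul, ← star_toCalkin]
    exact hn.star_comm_self
  have h := tendsto_zero_of_isCompactOperator e
    (d := fun n => ((‖α n‖ ^ 2 - (if n = 0 then 0 else ‖α (n - 1)‖ ^ 2) : ℝ) : ℂ)) (fun n => by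
      rw [sub_apply, hW.star_mul_self_apply]
      cases n with
      | zero => rw [hW.mul_star_self_apply_zero]; simp
      | succ n =>
        rw [hW.mul_star_self_apply_succ, ← sub_smul]
        simp) hc
  have h1 := ((tendsto_add_atTop_iff_nat 1).2 h).norm.sqrt
  rw [norm_zero, Real.sqrt_zero] at h1
  refine squeeze_zero_norm (fun n => ?_) h1
  -- For `x, y ≥ 0`, `|x - y|² ≤ |x - y| (x + y) = |x² - y²|`; no lower bound on the weights is
  -- needed.
  refine Real.le_sqrt_of_sq_le ?_
  simp only [Nat.succ_ne_zero, if_false, Nat.add_sub_cancel, Complex.norm_real, Real.norm_eq_abs]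
  rw [sq_sub_sq, abs_mul, sq]
  refine mul_le_mul_of_nonneg_right ?_ (abs_nonneg _)
  rw [abs_of_nonneg (by positivity : 0 ≤ ‖α (n + 1)‖ + ‖α n‖)]
  exact (abs_sub_le_iff.2 ⟨by linarith [norm_nonneg (α n)], by linarith [norm_nonneg (α (n + 1))]⟩)

/-! ### Words as walks on the basis -/

/-- `T` acts on a tail of the basis as a word in a weighted shift and its adjoint: it moves
`e (n + p)` to a multiple of `e (n + q)`, the modulus of the coefficient being the product of the
moduli of the weights met on the way, which are listed in `l`. -/
structure IsWalk (e : HilbertBasis ℕ ℂ H) (α : ℕ → ℂ) (T : H →L[ℂ] H) (p q : ℕ)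
    (l : Multiset ℕ) : Prop where
  apply : ∀ n, ∃ c : ℂ, T (e (n + p)) = c • e (n + q) ∧ ‖c‖ = (l.map fun j => ‖α (n + j)‖).prod
  -- A walk with unit steps must use every weight between its endpoints; this later supplies the
  -- factor to cancel.
  crosses : ∀ j, p ≤ j ∧ j < q ∨ q ≤ j ∧ j < p → j ∈ l

theorem IsWalk.shift {T : H →L[ℂ] H} {p q : ℕ} {l : Multiset ℕ} (h : IsWalk e α T p q l)
    (r : ℕ) : IsWalk e α T (p + r) (q + r) (l.map (· + r)) := by
  refine ⟨fun n => ?_, fun j hj => ?_⟩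
  · obtain ⟨c, hc, hcl⟩ := h.apply (n + r)
    refine ⟨c, ?_, ?_⟩
    · rw [← add_assoc, ← add_assoc, add_right_comm n p, add_right_comm n q, hc]
    · rw [hcl, Multiset.map_map]
      exact congrArg Multiset.prod (Multiset.map_congr rfl fun j _ => by
        simp [add_assoc, add_comm r])
  · exact Multiset.mem_map.2 ⟨j - r, h.crosses _ (by omega), by omega⟩

theorem IsWalk.mul {S T : H →L[ℂ] H} {p q r : ℕ} {l m : Multiset ℕ} (hS : IsWalk e α S q r l)
    (hT : IsWalk e α T p q m) : IsWalk e α (S * T) p r (l + m) := by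
  refine ⟨fun n => ?_, fun j hj => ?_⟩
  · obtain ⟨c, hc, hcl⟩ := hS.apply n
    obtain ⟨d, hd, hdl⟩ := hT.apply n
    refine ⟨d * c, ?_, ?_⟩
    · rw [mul_apply_eq_comp, hd, map_smul, hc, smul_smul]
    · rw [norm_mul, hcl, hdl, Multiset.map_add, Multiset.prod_add, mul_comm]
  · rw [Multiset.mem_add]
    by_cases h : q ≤ j ∧ j < r ∨ r ≤ j ∧ j < q
    · exact Or.inl (hS.crosses j h)
    · exact Or.inr (hT.crosses j (by omega))

/-- Shifting each walk by an endpoint of the other makes `T` end where `S` starts, at `p + q'`. -/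
theorem exists_isWalk_mul {S T : H →L[ℂ] H} {a b : ℕ}
    (hS : ∃ p q l, IsWalk e α S p q l ∧ a ≤ l.card)
    (hT : ∃ p q l, IsWalk e α T p q l ∧ b ≤ l.card) :
    ∃ p q l, IsWalk e α (S * T) p q l ∧ a + b ≤ l.card := by
  obtain ⟨p, q, l, hS, hl⟩ := hS
  obtain ⟨p', q', m, hT, hm⟩ := hT
  have hS' := hS.shift q'
  rw [add_comm p q'] at hS'
  refine ⟨_, _, _, hS'.mul (hT.shift p), ?_⟩
  simpa using add_le_add hl hm

theorem IsWeightedShift.isWalk (hW : IsWeightedShift e α W) : IsWalk e α W 0 1 {0} :=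
  ⟨fun n => ⟨α n, hW n, by simp⟩, fun j hj => by simp; omega⟩

theorem IsWeightedShift.isWalk_star [CompleteSpace H]
    (hW : IsWeightedShift e α W) :
    IsWalk e α (star W) 1 0 {0} :=
  ⟨fun n => ⟨star (α n), hW.star_apply_succ n, by simp⟩, fun j hj => by simp; omega⟩

theorem IsWeightedShift.exists_isWalk [CompleteSpace H]
    (hW : IsWeightedShift e α W) {T : H →L[ℂ] H}
    (hT : T ∈ selfadjointSemigroup W) : ∃ p q l, IsWalk e α T p q l ∧ 1 ≤ l.card := by
  induction hT using Subsemigroup.closure_induction with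
  | mem T hT =>
    rcases hT with rfl | rfl
    · exact ⟨_, _, _, hW.isWalk, by simp⟩
    · exact ⟨_, _, _, hW.isWalk_star, by simp⟩
  | mul S T _ _ hS hT =>
    obtain ⟨p, q, l, h, hl⟩ := exists_isWalk_mul hS hT
    exact ⟨p, q, l, h, by omega⟩

/-! ### The multiplicative relation from the SI property -/

/-- In an SI semigroup the adjoint of an element lies in its principal ideal. -/
theorem IsSISemigroup.star_eq {M : Type*} [Semigroup M] [Star M] {S : Subsemigroup M}
    (h : IsSISemigroup S) {T : M} (hT : T ∈ S) :
    star T = T ∨ (∃ X ∈ S, star T = X * T) ∨ (∃ Y ∈ S, star T = T * Y) ∨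
      ∃ X ∈ S, ∃ Y ∈ S, star T = X * T * Y := by
  refine h {R | R = T ∨ (∃ X ∈ S, R = X * T) ∨ (∃ Y ∈ S, R = T * Y) ∨
      ∃ X ∈ S, ∃ Y ∈ S, R = X * T * Y} ⟨?_, ?_⟩ T (Or.inl rfl)
  · rintro R (rfl | ⟨X, hX, rfl⟩ | ⟨Y, hY, rfl⟩ | ⟨X, hX, Y, hY, rfl⟩)
    · exact hT
    · exact S.mul_mem hX hT
    · exact S.mul_mem hT hY
    · exact S.mul_mem (S.mul_mem hX hT) hY
  · rintro Z hZ R (rfl | ⟨X, hX, rfl⟩ | ⟨Y, hY, rfl⟩ | ⟨X, hX, Y, hY, rfl⟩)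
    · exact ⟨Or.inr (Or.inl ⟨Z, hZ, rfl⟩), Or.inr (Or.inr (Or.inl ⟨Z, hZ, rfl⟩))⟩
    · exact ⟨Or.inr (Or.inl ⟨Z * X, S.mul_mem hZ hX, (mul_assoc _ _ _).symm⟩),
        Or.inr (Or.inr (Or.inr ⟨X, hX, Z, hZ, rfl⟩))⟩
    · exact ⟨Or.inr (Or.inr (Or.inr ⟨Z, hZ, Y, hY, (mul_assoc _ _ _).symm⟩)),
        Or.inr (Or.inr (Or.inl ⟨Y * Z, S.mul_mem hY hZ, mul_assoc _ _ _⟩))⟩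
    · exact ⟨Or.inr (Or.inr (Or.inr ⟨Z * X, S.mul_mem hZ hX, Y, hY, by simp only [mul_assoc]⟩)),
        Or.inr (Or.inr (Or.inr ⟨X, hX, Y * Z, S.mul_mem hY hZ, mul_assoc _ _ _⟩))⟩

/-- The SI property forces a translation-invariant multiplicative relation between the weights. -/
theorem IsWeightedShift.exists_prod_norm_eq_one [CompleteSpace H]
    (hW : IsWeightedShift e α W)
    (hα : ∀ n, α n ≠ 0) (hSI : IsSISemigroup (selfadjointSemigroup W)) :
    ∃ l : Multiset ℕ, l.card ≠ 0 ∧ ∀ n, (l.map fun j => ‖α (n + j)‖).prod = 1 := by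
  have hwalk : ∃ p q l, IsWalk e α (star W) p q l ∧ 2 ≤ l.card := by
    have hW1 : ∃ p q l, IsWalk e α W p q l ∧ 1 ≤ l.card := ⟨_, _, _, hW.isWalk, by simp⟩
    rcases hSI.star_eq (T := W) (Subsemigroup.subset_closure (by simp)) with
      h | ⟨X, hX, h⟩ | ⟨Y, hY, h⟩ | ⟨X, hX, Y, hY, h⟩
    · have h0 := hW 0
      rw [← h, hW.star_apply_zero] at h0
      exact absurd h0.symm (smul_ne_zero (hα 0) (e.orthonormal.ne_zero 1))
    · rw [h]; exact exists_isWalk_mul (hW.exists_isWalk hX) hW1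
    · rw [h]; exact exists_isWalk_mul hW1 (hW.exists_isWalk hY)
    · rw [h]
      obtain ⟨p, q, l, hl, hlc⟩ := exists_isWalk_mul
        (exists_isWalk_mul (hW.exists_isWalk hX) hW1) (hW.exists_isWalk hY)
      exact ⟨p, q, l, hl, by omega⟩
  obtain ⟨p, q, l, h, hl⟩ := hwalk
  have hpos : ∀ (m : Multiset ℕ) n, 0 < (m.map fun j => ‖α (n + j)‖).prod := fun m n =>
    Multiset.prod_pos fun x hx => by
      obtain ⟨j, -, rfl⟩ := Multiset.mem_map.1 hx
      exact norm_pos_iff.2 (hα _)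
  have key : ∀ n, p = q + 1 ∧ ‖α (n + q)‖ = (l.map fun j => ‖α (n + j)‖).prod := by
    intro n
    obtain ⟨c, hc, hcl⟩ := h.apply n
    have hc0 : c ≠ 0 := norm_pos_iff.1 (hcl ▸ hpos l n)
    cases hnp : n + p with
    | zero =>
      rw [hnp, hW.star_apply_zero] at hc
      exact absurd hc.symm (smul_ne_zero hc0 (e.orthonormal.ne_zero _))
    | succ k =>
      rw [hnp, hW.star_apply_succ] at hc
      have h1 := congrArg (inner ℂ (e (n + q))) hc
      rw [inner_smul_right, inner_smul_right, orthonormal_iff_ite.1 e.orthonormal,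
        orthonormal_iff_ite.1 e.orthonormal, if_pos rfl, mul_one] at h1
      by_cases hk : n + q = k
      · refine ⟨by omega, ?_⟩
        rw [if_pos hk, mul_one] at h1
        rw [hk, ← hcl, ← h1, norm_star]
      · rw [if_neg hk, mul_zero] at h1
        exact absurd h1.symm hc0
  -- The walk goes from `q + 1` to `q`, so it crosses `q`. Removing one copy leaves a nonempty
  -- multiset because `l` has at least two elements.
  have hq : q ∈ l := h.crosses q (by have := (key 0).1; omega)
  obtain ⟨m, rfl⟩ := Multiset.exists_cons_of_mem hq
  refine ⟨m, by rw [Multiset.card_cons] at hl; omega, fun n => ?_⟩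
  have h2 := (key n).2
  rw [Multiset.map_cons, Multiset.prod_cons] at h2
  exact (mul_eq_left₀ (norm_pos_iff.2 (hα (n + q))).ne').1 h2.symm

/-! ### Limits and growth of weight products -/

/-- A bounded, slowly varying, nonnegative sequence satisfying a multiplicative relation tends
to `1`. -/
theorem tendsto_one_of_prod_eq_one {a : ℕ → ℝ} {C : ℝ} (h0 : ∀ n, 0 ≤ a n) (hC : ∀ n, a n ≤ C)
    (hs : Tendsto (fun n => a (n + 1) - a n) atTop (𝓝 0)) {l : Multiset ℕ} (hl : l.card ≠ 0)
    (hp : ∀ n, (l.map fun j => a (n + j)).prod = 1) : Tendsto a atTop (𝓝 1) := by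
  refine tendsto_of_subseq_tendsto fun ns hns => ?_
  obtain ⟨L, hL, ms, hms, hlim⟩ := isCompact_Icc.tendsto_subseq
    (x := fun n => a (ns n)) (s := Set.Icc 0 C) fun n => ⟨h0 _, hC _⟩
  refine ⟨ms, ?_⟩
  have hk : Tendsto (fun k => ns (ms k)) atTop atTop := hns.comp hms.tendsto_atTop
  -- Slow variation gives all translates the same limit along the subsequence.
  have hshift : ∀ j, Tendsto (fun k => a (ns (ms k) + j)) atTop (𝓝 L) := by
    intro j
    induction j with
    | zero => exact hlim
    | succ j ih =>
      have h1 := (hs.comp ((tendsto_add_atTop_nat j).comp hk)).add ih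
      rw [zero_add] at h1
      refine h1.congr fun k => ?_
      simp only [Function.comp, add_assoc, sub_add_cancel]
  have hprod := tendsto_multiset_prod (f := fun j k => a (ns (ms k) + j)) l
    (a := fun _ => L) (x := atTop) fun j _ => hshift j
  simp only [hp, Multiset.map_const', Multiset.prod_replicate] at hprod
  have hL1 : L ^ l.card = 1 := tendsto_nhds_unique hprod tendsto_const_nhds
  rw [(pow_eq_one_iff_of_nonneg hL.1 hl).1 hL1] at hlim
  exact hlim

/-- The geometric means of a positive sequence tending to `1` tend to `1`. -/
theorem tendsto_prod_rpow_one {a : ℕ → ℝ} (h0 : ∀ n, 0 < a n) (ha : Tendsto a atTop (𝓝 1)) :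
    Tendsto (fun n : ℕ => (∏ i ∈ Finset.range n, a i) ^ (1 / (n : ℝ))) atTop (𝓝 1) := by
  have h1 : Tendsto (fun n => Real.log (a n)) atTop (𝓝 0) := by
    simpa using ha.log one_ne_zero
  have h2 := (Real.continuous_exp.tendsto 0).comp h1.cesaro
  rw [Real.exp_zero] at h2
  refine h2.congr fun n => ?_
  rw [Real.rpow_def_of_pos (Finset.prod_pos fun i _ => h0 i), Real.log_prod fun i _ => (h0 i).ne',
    Function.comp, one_div, mul_comm]

/-- At most `N` factors have index below `N`. The bound is uniform in `n`, as needed to estimate `‖W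
^ k‖`. -/
theorem prod_range_le_of_eventually_le {a : ℕ → ℝ} {B b : ℝ} {N : ℕ} (h0 : ∀ n, 0 ≤ a n)
    (hB : ∀ n, a n ≤ B) (hB1 : 1 ≤ B) (hb1 : 1 ≤ b) (hb : ∀ n, N ≤ n → a n ≤ b) (k n : ℕ) :
    ∏ i ∈ Finset.range k, a (n + i) ≤ B ^ N * b ^ k := by
  -- The exponent `min k (N - n)` counts the factors with index below `N`.
  have h1 : ∀ k, ∏ i ∈ Finset.range k, a (n + i) ≤ B ^ (min k (N - n)) * b ^ k := by
    intro k
    induction k with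
    | zero => simp
    | succ k ih =>
      rw [Finset.prod_range_succ]
      by_cases hk : N ≤ n + k
      · rw [show min (k + 1) (N - n) = min k (N - n) by omega, pow_succ, ← mul_assoc]
        exact mul_le_mul ih (hb _ hk) (h0 _) (by positivity)
      · rw [show min (k + 1) (N - n) = min k (N - n) + 1 by omega, pow_succ B, mul_right_comm]
        refine mul_le_mul (ih.trans ?_) (hB _) (h0 _) (by positivity)
        gcongr
        omega
  refine (h1 k).trans ?_
  gcongr
  omega

theorem le_one_of_pow_le_mul_pow {x : ℝ} (h : ∀ b, 1 < b → ∃ C, ∀ k : ℕ, x ^ k ≤ C * b ^ k) :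
    x ≤ 1 := by
  by_contra! hx
  obtain ⟨b, hb, hbx⟩ := exists_between hx
  obtain ⟨C, hC⟩ := h b hb
  have hb0 : 0 < b := by linarith
  have ht := tendsto_pow_atTop_atTop_of_one_lt ((one_lt_div hb0).2 hbx)
  obtain ⟨k, hk⟩ := (ht.eventually_gt_atTop C).exists
  rw [div_pow, lt_div_iff₀ (by positivity)] at hk
  exact absurd (hC k) hk.not_ge

/-! ### Spectrum and essential spectrum -/

theorem IsWeightedShift.spectrum_subset_closedBall [CompleteSpace H]
    (hW : IsWeightedShift e α W)
    (hlim : Tendsto (fun n => ‖α n‖) atTop (𝓝 1)) :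
    spectrum ℂ W ⊆ Metric.closedBall 0 1 := by
  intro z hz
  rw [mem_closedBall_zero_iff]
  refine le_one_of_pow_le_mul_pow fun b hb => ?_
  obtain ⟨N, hN⟩ := eventually_atTop.1 (hlim.eventually_le_const hb)
  refine ⟨max 1 ‖W‖ ^ N, fun k => ?_⟩
  rw [← norm_pow]
  have : Nontrivial H := ⟨⟨e 0, 0, e.orthonormal.ne_zero 0⟩⟩
  refine (spectrum.norm_le_norm_of_mem (spectrum.pow_mem_pow W k hz)).trans ?_
  refine norm_le_of_apply_basis e (by positivity) (hW.pow_apply k) fun n => ?_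
  rw [norm_prod]
  exact prod_range_le_of_eventually_le (fun n => norm_nonneg (α n))
    (fun n => (hW.norm_weight_le n).trans (le_max_right _ _)) (le_max_left _ _) hb.le hN k n

/-- `z - W` misses `e 0`: a solution of `(z - W) x = e 0` forces `z ≠ 0` and coordinates `α 0 ⋯ α (n
- 1) / z ^ (n + 1)`, which are unbounded when `|z| < 1`. -/
theorem IsWeightedShift.ball_subset_spectrum [CompleteSpace H]
    (hW : IsWeightedShift e α W)
    (hα : ∀ n, α n ≠ 0) (hlim : Tendsto (fun n => ‖α n‖) atTop (𝓝 1)) :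
    Metric.ball 0 1 ⊆ spectrum ℂ W := by
  intro z hz hu
  rw [mem_ball_zero_iff] at hz
  obtain ⟨u, hu⟩ := hu
  obtain ⟨x, hx⟩ : ∃ x : H, (algebraMap ℂ (H →L[ℂ] H) z - W) x = e 0 := by
    refine ⟨(↑u⁻¹ : H →L[ℂ] H) (e 0), ?_⟩
    rw [← hu, ← mul_apply_eq_comp, u.mul_inv]
    rfl
  have hx' : z • x - W x = e 0 := by
    simpa [Algebra.algebraMap_eq_smul_one] using hx
  have hWx : ∀ n, inner ℂ (e n) (W x) = inner ℂ (star W (e n)) x := fun n => by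
    rw [ContinuousLinearMap.star_eq_adjoint, ContinuousLinearMap.adjoint_inner_left]
  have hx0 : z * inner ℂ (e 0) x = 1 := by
    have := congrArg (inner ℂ (e 0)) hx'
    rwa [inner_sub_right, inner_smul_right, hWx, hW.star_apply_zero, inner_zero_left, sub_zero,
      orthonormal_iff_ite.1 e.orthonormal, if_pos rfl] at this
  have hxs : ∀ n, z * inner ℂ (e (n + 1)) x = α n * inner ℂ (e n) x := by
    intro n
    have := congrArg (inner ℂ (e (n + 1))) hx'
    rw [inner_sub_right, inner_smul_right, hWx, hW.star_apply_succ, inner_smul_left,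
      orthonormal_iff_ite.1 e.orthonormal, if_neg (Nat.succ_ne_zero n), sub_eq_zero] at this
    simpa using this
  have hxn : ∀ n, z ^ (n + 1) * inner ℂ (e n) x = ∏ i ∈ Finset.range n, α i := by
    intro n
    induction n with
    | zero => simpa using hx0
    | succ n ih =>
      rw [Finset.prod_range_succ, ← ih, pow_succ, mul_assoc, hxs]
      ring
  have hz0 : 0 < ‖z‖ := norm_pos_iff.2 (left_ne_zero_of_mul_eq_one hx0)
  obtain ⟨b, hzb, hb⟩ := exists_between hz
  have hb0 : 0 < b := hz0.trans hzb
  obtain ⟨N, hN⟩ := eventually_atTop.1 (hlim.eventually_const_le hb)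
  have hlow : ∀ k, ‖∏ i ∈ Finset.range N, α i‖ * b ^ k ≤ ‖∏ i ∈ Finset.range (N + k), α i‖ := by
    intro k
    induction k with
    | zero => simp
    | succ k ih =>
      rw [← add_assoc, Finset.prod_range_succ, norm_mul, pow_succ, ← mul_assoc]
      exact mul_le_mul ih (hN _ (by omega)) hb0.le (norm_nonneg _)
  have hup : ∀ n, ‖∏ i ∈ Finset.range n, α i‖ ≤ ‖z‖ ^ (n + 1) * ‖x‖ := by
    intro n
    rw [← hxn, norm_mul, norm_pow]
    gcongr
    simpa [e.orthonormal.1] using norm_inner_le_norm (𝕜 := ℂ) (e n) x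
  have hP : 0 < ‖∏ i ∈ Finset.range N, α i‖ :=
    norm_pos_iff.2 (Finset.prod_ne_zero_iff.2 fun i _ => hα i)
  have ht := tendsto_pow_atTop_atTop_of_one_lt ((one_lt_div hz0).2 hzb)
  obtain ⟨k, hk⟩ := (ht.eventually_gt_atTop
    (‖z‖ ^ (N + 1) * ‖x‖ / ‖∏ i ∈ Finset.range N, α i‖)).exists
  rw [div_pow, div_lt_div_iff₀ hP (by positivity)] at hk
  have h1 := (hlow k).trans (hup (N + k))
  rw [show N + k + 1 = N + 1 + k by omega, pow_add] at h1
  nlinarith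

theorem IsWeightedShift.toCalkin_star_mul_self [CompleteSpace H]
    (hW : IsWeightedShift e α W)
    (hlim : Tendsto (fun n => ‖α n‖) atTop (𝓝 1)) :
    toCalkin (star W) * toCalkin W = 1 := by
  rw [← map_mul, ← map_one toCalkin, toCalkin_eq_iff]
  refine isCompactOperator_of_tendsto_zero e (d := fun n => ((‖α n‖ ^ 2 - 1 : ℝ) : ℂ))
    (fun n => ?_) ?_
  · rw [sub_apply, hW.star_mul_self_apply]
    simp [sub_smul]
  · have h := Complex.continuous_ofReal.continuousAt.tendsto.comp ((hlim.pow 2).sub_const 1)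
    simpa [Function.comp_def] using h

/-- For `|z| < 1`, unitarity of `π(W)` gives `z - π(W) = -π(W) π(1 - z W*)`. The last factor is
invertible already in `B(H)`, since for `z ≠ 0` the inverse of the conjugate of `z` lies outside the
closed disc containing `σ(W)`. -/
theorem IsWeightedShift.essentialSpectrum_subset_sphere [CompleteSpace H]
    (hW : IsWeightedShift e α W)
    (hn : IsEssentiallyNormal W) (hlim : Tendsto (fun n => ‖α n‖) atTop (𝓝 1)) :
    essentialSpectrum W ⊆ Metric.sphere 0 1 := by
  intro z hz
  rw [mem_sphere_zero_iff_norm]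
  have h1 := hW.toCalkin_star_mul_self hlim
  have h2 : toCalkin W * toCalkin (star W) = 1 := by
    rw [← h1, ← star_toCalkin]
    exact hn.star_comm_self.eq.symm
  have hsub := hW.spectrum_subset_closedBall hlim
  have hle : ‖z‖ ≤ 1 := mem_closedBall_zero_iff.1 (hsub (AlgHom.spectrum_apply_subset toCalkin W hz))
  refine hle.antisymm (not_lt.1 fun hlt => hz ?_)
  have hVu : IsUnit (toCalkin W) := ⟨⟨_, _, h2, h1⟩, rfl⟩
  have hu : IsUnit (1 - z • star W) := by
    rcases eq_or_ne z 0 with rfl | hz0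
    · simp
    · have h3 : (star z)⁻¹ ∉ spectrum ℂ W := fun h => by
        have := mem_closedBall_zero_iff.1 (hsub h)
        rw [norm_inv, norm_star] at this
        exact absurd this (not_le.2 ((one_lt_inv₀ (norm_pos_iff.2 hz0)).2 hlt))
      have h4 := (spectrum.notMem_iff.1 h3).star.smul (Units.mk0 z hz0)
      have h5 : Units.mk0 z hz0 • star (algebraMap ℂ (H →L[ℂ] H) (star z)⁻¹ - W) =
          1 - z • star W := by
        rw [Units.smul_mk0, star_sub, smul_sub, Algebra.algebraMap_eq_smul_one, star_smul, star_one,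
          star_inv₀, star_star, smul_smul, mul_inv_cancel₀ hz0, one_smul]
      rwa [h5] at h4
  have h6 := (hVu.mul (hu.map toCalkin)).neg
  suffices h7 : algebraMap ℂ (CalkinAlgebra H) z - toCalkin W =
      -(toCalkin W * toCalkin (1 - z • star W)) from
    spectrum.mem_resolventSet_iff.2 (h7 ▸ h6)
  rw [map_sub, map_one, map_smul, mul_sub, mul_smul_comm, h2, mul_one, neg_sub,
    Algebra.algebraMap_eq_smul_one]

end WeightedShift

theorem mainTheorem5 {H : Type*} [NormedAddCommGroup H] [InnerProductSpace ℂ H] [CompleteSpace H]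
    (e : HilbertBasis ℕ ℂ H) (α : ℕ → ℂ) (W : H →L[ℂ] H)
    (hW : IsWeightedShift e α W) (hα : ∀ n, α n ≠ 0)
    (hnormal : IsEssentiallyNormal W) (hSI : IsSISemigroup (selfadjointSemigroup W)) :
    essentialSpectrum W ⊆ Metric.sphere (0 : ℂ) 1 ∪ {0} ∧
      spectrum ℂ W = Metric.closedBall (0 : ℂ) 1 ∧
      liminf (fun n : ℕ => ‖∏ i ∈ Finset.range n, α i‖ ^ (1 / (n : ℝ))) atTop = 1 := by
  obtain ⟨l, hl, hp⟩ := hW.exists_prod_norm_eq_one hα hSI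
  have hlim : Tendsto (fun n => ‖α n‖) atTop (𝓝 1) :=
    tendsto_one_of_prod_eq_one (fun n => norm_nonneg _) hW.norm_weight_le
      (hW.tendsto_norm_succ_sub_norm hnormal) hl hp
  refine ⟨(hW.essentialSpectrum_subset_sphere hnormal hlim).trans Set.subset_union_left,
    (hW.spectrum_subset_closedBall hlim).antisymm ?_, ?_⟩
  · rw [← closure_ball (0 : ℂ) one_ne_zero]
    exact closure_minimal (hW.ball_subset_spectrum hα hlim) (spectrum.isClosed W)
  · refine Tendsto.liminf_eq ?_
    simp only [norm_prod]
    exact tendsto_prod_rpow_one (fun n => norm_pos_iff.2 (hα n)) hlim
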